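/- Let $\mathcal G=(\mathcal V,\mathcal E)$ be a finite connected graph with $N$ nodes and symmetric edge weights (susceptances) $b_{ij}>0$ for $(ij)\in\mathcal E$, and let $L_b$ be its weighted Laplacian: $L_b(i,j)=-b_{ij}$ if $(ij)\in\mathcal E$, $L_b(i,i)=\sum_{(ij)\in\mathcal E}b_{ij}$, and all other entries are $0$. Let $L_b^+$ be the Moore–Penrose pseudo-inverse of $L_b$. Let $M=\mathrm{diag}(M_i)$ with all $M_i>0$ and $D=\mathrm{diag}(D_i)$ with $D_i=d$ for all $i$, where $d>0$. Let $w_{ij}=w_{ji}\ge 0$ $(i\ne j)$ and $s_i\ge 0$, let $L_w$ be the Laplacian of the graph on $\mathcal V$ with edge weights $w_{ij}$, and let $S=\mathrm{diag}(s_i)$. Consider the linear time-invariant system with state $(\theta,\omega)\in\mathbb R^{2N}$, input $u$ and output $y$, $$\begin{bmatrix}\dot\theta\\ \dot\omega\end{bmatrix}=A\begin{bmatrix}\theta\\ \omega\end{bmatrix}+Bu,\quad y=C\begin{bmatrix}\theta\\ \omega\end{bmatrix},\qquad A=\begin{bmatrix}0&\mathbb I\\-M^{-1}L_b&-M^{-1}D\end{bmatrix},\quad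 B=\begin{bmatrix}0\\M^{-1}\end{bmatrix},\quad C=\begin{bmatrix}L_w^{1/2}&0\\0&S^{1/2}\end{bmatrix},$$ where the square roots are the positive semidefinite ones. Then the $\mathcal H_2$ norm of the system is finite and $$\|H\|_{\mathcal H_2}^2=\frac{\mathrm{Tr}(L_wL_b^+)+\mathrm{Tr}(SM^{-1})}{2d}.$$ This holds both for $\|H\|_{\mathcal H_2}^2=\int_0^\infty\mathrm{Tr}\big((Ce^{At}B)^T(Ce^{At}B)\big)\,dt$, the squared $L^2$ norm of the impulse response, and for $\|H\|_{\mathcal H_2}^2=\lim_{t\to\infty}\mathbb E\{y^T(t)y(t)\}$, the steady-state output variance when $u$ is standard white noise (the formal derivative of a standard $N$-dimensional Brownian motion) and the initial state is any square-integrable random vector; in the latter case $y^T(t)y(t)$ is integrable for every $t\ge 0$. -/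

import Mathlib

open MeasureTheory ProbabilityTheory Matrix Filter Topology
open scoped NNReal MatrixOrder

universe u

/-- The Laplacian of the graph `G` whose edge `ij` carries the weight `w i j`. -/
def weightedLaplacian {V : Type*} [Fintype V] [DecidableEq V] (G : SimpleGraph V)
    [DecidableRel G.Adj] (w : V → V → ℝ) : Matrix V V ℝ :=
  Matrix.of fun i j =>
    if i = j then ∑ k, (if G.Adj i k then w i k else 0)
    else if G.Adj i j then -w i j else 0

/-- The four Penrose conditions: `X` is the Moore–Penrose pseudo-inverse of the real matrix `A`. -/
structure IsMoorePenroseInverse {m n : Type*} [Fintype m] [Fintype n]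
    (A : Matrix m n ℝ) (X : Matrix n m ℝ) : Prop where
  mul_mul_self : A * X * A = A
  mul_mul_inv : X * A * X = X
  symm_left : (A * X)ᵀ = A * X
  symm_right : (X * A)ᵀ = X * A

theorem IsMoorePenroseInverse.unique {m n : Type*} [Fintype m] [Fintype n]
    {A : Matrix m n ℝ} {X Y : Matrix n m ℝ}
    (hX : IsMoorePenroseInverse A X) (hY : IsMoorePenroseInverse A Y) : X = Y := by
  have h1 : A * X = A * Y := by
    calc A * X = (A * Y * A) * X := by rw [hY.mul_mul_self]
      _ = (A * Y)ᵀ * (A * X)ᵀ := by rw [hY.symm_left, hX.symm_left]; simp only [Matrix.mul_assoc]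
      _ = (A * X * A * Y)ᵀ := by rw [← Matrix.transpose_mul]; simp only [Matrix.mul_assoc]
      _ = A * Y := by rw [hX.mul_mul_self, hY.symm_left]
  have h2 : X * A = Y * A := by
    calc X * A = X * (A * Y * A) := by rw [hY.mul_mul_self]
      _ = (X * A)ᵀ * (Y * A)ᵀ := by rw [hY.symm_right, hX.symm_right]; simp only [Matrix.mul_assoc]
      _ = (Y * (A * X * A))ᵀ := by rw [← Matrix.transpose_mul]; simp only [Matrix.mul_assoc]
      _ = Y * A := by rw [hX.mul_mul_self, hY.symm_right]
  calc X = X * (A * X) := by rw [← Matrix.mul_assoc, hX.mul_mul_inv]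
    _ = (X * A) * Y := by rw [h1, Matrix.mul_assoc]
    _ = Y := by rw [h2, hY.mul_mul_inv]

theorem exists_isMoorePenroseInverse_of_isHermitian {n : Type*} [Fintype n] [DecidableEq n]
    {A : Matrix n n ℝ} (hA : A.IsHermitian) : ∃ X, IsMoorePenroseInverse A X := by
  have hsa : IsSelfAdjoint A := hA
  have hc : ∀ f : ℝ → ℝ, ContinuousOn f (spectrum ℝ A) := fun f =>
    (Matrix.finite_real_spectrum (A := A)).continuousOn f
  have hid : cfc (fun x : ℝ => x) A = A := cfc_id' ℝ A
  have hs : ∀ f : ℝ → ℝ, (cfc f A)ᵀ = cfc f A := fun f => by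
    have h : IsSelfAdjoint (cfc f A) := cfc_predicate f A
    simpa [IsSelfAdjoint, star_eq_conjTranspose] using h
  have h1 : A * cfc (fun x : ℝ => x⁻¹) A = cfc (fun x : ℝ => x * x⁻¹) A := by
    rw [cfc_mul _ _ A (hc _) (hc _), hid]
  have h2 : cfc (fun x : ℝ => x⁻¹) A * A = cfc (fun x : ℝ => x⁻¹ * x) A := by
    rw [cfc_mul _ _ A (hc _) (hc _), hid]
  refine ⟨cfc (fun x : ℝ => x⁻¹) A, ?_, ?_, ?_, ?_⟩
  · calc _ = cfc (fun x : ℝ => x * x⁻¹) A * cfc (fun x : ℝ => x) A := by rw [h1, hid]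
      _ = cfc (fun x : ℝ => x) A := by
        rw [← cfc_mul _ _ A (hc _) (hc _)]
        congr 1; funext x; exact mul_inv_mul_cancel x
      _ = A := hid
  · rw [h2, ← cfc_mul _ _ A (hc _) (hc _)]
    congr 1; funext x
    by_cases hx : x = 0 <;> simp [hx]
  · rw [h1, hs]
  · rw [h2, hs]

open Classical in
/-- The Moore–Penrose pseudo-inverse `A⁺`: the unique matrix satisfying the Penrose conditions. -/
noncomputable def pinv {m n : Type*} [Fintype m] [Fintype n] (A : Matrix m n ℝ) :
    Matrix n m ℝ :=
  if h : ∃ X, IsMoorePenroseInverse A X then h.choose else 0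

theorem pinv_spec {n : Type*} [Fintype n] [DecidableEq n]
    {A : Matrix n n ℝ} (hA : A.IsHermitian) : IsMoorePenroseInverse A (pinv A) := by
  have h := exists_isMoorePenroseInverse_of_isHermitian hA
  rw [pinv, dif_pos h]
  exact h.choose_spec

/-- State matrix of the linearized swing dynamics, acting on `(θ, ω)`. -/
noncomputable def swingA {V : Type*} [Fintype V] [DecidableEq V] (M D L : Matrix V V ℝ) :
    Matrix (V ⊕ V) (V ⊕ V) ℝ :=
  Matrix.fromBlocks 0 1 (-(M⁻¹ * L)) (-(M⁻¹ * D))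

/-- Input matrix of the linearized swing dynamics. -/
noncomputable def swingB {V : Type*} [Fintype V] [DecidableEq V] (M : Matrix V V ℝ) :
    Matrix (V ⊕ V) V ℝ :=
  Matrix.fromRows 0 M⁻¹

/-- Output matrix; `CFC.sqrt` is the positive semidefinite square root. -/
noncomputable def swingC {V : Type*} [Fintype V] [DecidableEq V] (Lw S : Matrix V V ℝ) :
    Matrix (V ⊕ V) (V ⊕ V) ℝ :=
  Matrix.fromBlocks (CFC.sqrt Lw) 0 0 (CFC.sqrt S)

/-- Impulse response `t ↦ C exp(tA) B` of the system `ẋ = Ax + Bu`, `y = Cx`. -/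
noncomputable def impulseResponse {n k p : Type*} [Fintype n] [DecidableEq n]
    (A : Matrix n n ℝ) (B : Matrix n k ℝ) (C : Matrix p n ℝ) (t : ℝ) : Matrix p k ℝ :=
  C * NormedSpace.exp (t • A) * B

/-- The system `(A, B, C)` has finite `H₂` norm, with square `h`: the squared Frobenius norm of
its impulse response is integrable over `(0, ∞)`, with integral `h`. -/
def HasH2NormSq {n k p : Type*} [Fintype n] [DecidableEq n] [Fintype k] [Fintype p]
    (A : Matrix n n ℝ) (B : Matrix n k ℝ) (C : Matrix p n ℝ) (h : ℝ) : Prop :=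
  IntegrableOn
    (fun t => ((impulseResponse A B C t)ᵀ * impulseResponse A B C t).trace) (Set.Ioi 0) ∧
  ∫ t in Set.Ioi (0 : ℝ),
    ((impulseResponse A B C t)ᵀ * impulseResponse A B C t).trace = h

/-- `W` is a standard Brownian motion in `ℝᵏ`: its coordinates are independent standard real
Brownian motions. Its formal derivative is unit-intensity white noise. -/
structure IsStdBrownian {k Ω : Type*} [MeasurableSpace Ω]
    (W : k → ℝ≥0 → Ω → ℝ) (P : Measure Ω) : Prop where
  brownian : ∀ i, IsBrownianReal (W i) P
  indep : iIndepFun (fun i ω (t : ℝ≥0) => W i t ω) P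

/-- `x` is a solution of `dx = A x dt + B dW`, i.e. of `ẋ = Ax + Bu` with `u` the white noise
`dW/dt`: almost surely, the path is continuous and satisfies the integral equation at every time.
(The noise is additive, so the stochastic integral of the constant `B` is `B W`.) -/
def IsWhiteNoiseSolution {n k Ω : Type*} [Fintype n] [Fintype k] [MeasurableSpace Ω]
    (A : Matrix n n ℝ) (B : Matrix n k ℝ) (W : k → ℝ≥0 → Ω → ℝ)
    (x : ℝ≥0 → Ω → n → ℝ) (P : Measure Ω) : Prop :=
  ∀ᵐ ω ∂P, Continuous (fun t => x t ω) ∧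
    ∀ t : ℝ≥0, x t ω = x 0 ω + (∫ s in (0 : ℝ)..t, A *ᵥ x s.toNNReal ω)
      + B *ᵥ (fun i => W i t ω)

/-- The system `(A, B, C)` driven by white noise has steady-state output variance `h`: for every
standard Brownian motion and every solution started from a square-integrable state, the output
`y = C x` is square integrable at all times and `E[yᵀ(t) y(t)] → h` as `t → ∞`. -/
def HasSteadyStateVariance {n k p : Type*} [Fintype n] [Fintype k] [Fintype p]
    (A : Matrix n n ℝ) (B : Matrix n k ℝ) (C : Matrix p n ℝ) (h : ℝ) : Prop :=
  ∀ (Ω : Type u) [MeasurableSpace Ω] (P : Measure Ω) [IsProbabilityMeasure P]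
    (W : k → ℝ≥0 → Ω → ℝ) (x : ℝ≥0 → Ω → n → ℝ),
    IsStdBrownian W P → IsWhiteNoiseSolution A B W x P → MemLp (x 0) 2 P →
    (∀ t, Integrable (fun ω => (C *ᵥ x t ω) ⬝ᵥ (C *ᵥ x t ω)) P) ∧
    Tendsto (fun t => ∫ ω, (C *ᵥ x t ω) ⬝ᵥ (C *ᵥ x t ω) ∂P) atTop (𝓝 h)

/-! The matrix `P = (2d)⁻¹ diag(L_b⁺, M⁻¹)` almost solves the Lyapunov equation `AP + PAᵀ + BBᵀ =
0`: by `swing_lyapunov` the residual consists of off-diagonal blocks built from the projections `1 -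
L_b⁺L_b` and `1 - L_bL_b⁺`. These blocks take values in `ker L_b`, so they are fixed by `exp(tA)`.
If `C exp(tA) → 0`, a fixed direction has zero output at all times, and the residual is never seen.
Then `-Tr(C exp(tA) P exp(tA)ᵀ Cᵀ)` is an antiderivative of the squared impulse response. It
vanishes at infinity, so the integral is `Tr(CPCᵀ) = Tr(CᵀC P)`, which is the stated value.

`A` is not Hurwitz, since a common phase shift is an equilibrium, so only output stability `C
exp(tA) → 0` is available. It comes from an energy argument (`tendsto_energy_zero`): kinetic energy
and `θᵀL_bθ` decay. By connectedness the latter controls all phase differences, which are all that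
`L_w` sees.

For the white-noise statement, variation of constants is applied path by path and yields `y = C
exp(tA) x₀ + g`. Here `g` is a Wiener integral with smooth deterministic kernel, defined through
integration by parts so that no stochastic integration is needed. The isometry gives `E|g|²` as the
integral of the squared impulse response up to `t`. The terms involving `x₀` carry the factor `C
exp(tA)` and vanish in the limit. -/

/-! ### Path-continuous processes: measurability and exchange of time integral and expectation -/

/-- A process with almost surely continuous paths is, almost surely at all times simultaneously,
equal to a jointly measurable one. -/
theorem exists_measurable_uncurry_of_ae_continuous {Ω : Type*} [MeasurableSpace Ω]
    {P : Measure Ω} {X : ℝ≥0 → Ω → ℝ} (hX : ∀ t, AEMeasurable (X t) P)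
    (hc : ∀ᵐ ω ∂P, Continuous fun t => X t ω) :
    ∃ Y : ℝ≥0 → Ω → ℝ, Measurable (Function.uncurry Y) ∧ ∀ᵐ ω ∂P, ∀ t, X t ω = Y t ω := by
  classical
  let q := TopologicalSpace.denseSeq ℝ≥0
  have hae : ∀ᵐ ω ∂P, (Continuous fun t => X t ω) ∧ ∀ n, X (q n) ω = (hX (q n)).mk _ ω :=
    hc.and (ae_all_iff.2 fun n => (hX (q n)).ae_eq_mk)
  obtain ⟨N, hN, hNm, hN0⟩ := exists_measurable_superset_of_null (ae_iff.1 hae)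
  have hgood : ∀ ω ∈ Nᶜ, (Continuous fun t => X t ω) ∧ ∀ n, X (q n) ω = (hX (q n)).mk _ ω := by
    intro ω hω
    by_contra h
    exact hω (hN h)
  -- Zeroing on one measurable null set makes every path continuous. Measurability is then needed
  -- only at countably many dense times and passes to all times by pointwise limits.
  let Y : ℝ≥0 → Ω → ℝ := fun t => Nᶜ.indicator (X t)
  have hYc : ∀ ω, Continuous fun t => Y t ω := by
    intro ω
    by_cases hω : ω ∈ Nᶜ
    · simpa [Y, Set.indicator_of_mem hω] using (hgood ω hω).1
    · simpa [Y, Set.indicator_of_notMem hω] using continuous_const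
  have hYq : ∀ n, Measurable (Y (q n)) := by
    intro n
    have : Y (q n) = Nᶜ.indicator ((hX (q n)).mk _) := by
      funext ω
      by_cases hω : ω ∈ Nᶜ
      · simp only [Y, Set.indicator_of_mem hω, (hgood ω hω).2 n]
      · simp only [Y, Set.indicator_of_notMem hω]
    rw [this]
    exact (hX (q n)).measurable_mk.indicator hNm.compl
  have hYm : ∀ t, Measurable (Y t) := by
    intro t
    obtain ⟨u, hu, hut⟩ := mem_closure_iff_seq_limit.1 (TopologicalSpace.denseRange_denseSeq ℝ≥0 t)
    refine measurable_of_tendsto_metrizable (f := fun n => Y (u n)) (fun n => ?_)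
      (tendsto_pi_nhds.2 fun ω => ((hYc ω).tendsto t).comp hut)
    obtain ⟨m, hm⟩ := hu n
    rw [← hm]
    exact hYq m
  refine ⟨Y, measurable_uncurry_of_continuous_of_measurable hYc hYm, ?_⟩
  have : ∀ᵐ ω ∂P, ω ∈ Nᶜ := compl_mem_ae_iff.2 hN0
  filter_upwards [this] with ω hω t
  simp only [Y, Set.indicator_of_mem hω]

/-- The square of an integral over `[0, T]` is at most `T` times the integral of the square. -/
theorem sq_intervalIntegral_le {T : ℝ} (hT : 0 ≤ T) {f : ℝ → ℝ} (hf : Continuous f) :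
    (∫ s in (0 : ℝ)..T, f s) ^ 2 ≤ T * ∫ s in (0 : ℝ)..T, f s ^ 2 := by
  rcases hT.eq_or_lt with rfl | hT
  · simp
  set c := (∫ s in (0 : ℝ)..T, f s) with hc
  -- Nonnegativity of the variance of `f`, scaled by `T` to avoid division: the integral equals `T
  -- (T ∫ f² - c²)`.
  have h : 0 ≤ ∫ s in (0 : ℝ)..T, (T * f s - c) ^ 2 :=
    intervalIntegral.integral_nonneg hT.le fun s _ => sq_nonneg _
  have e : ∫ s in (0 : ℝ)..T, (T * f s - c) ^ 2
      = T ^ 2 * (∫ s in (0 : ℝ)..T, f s ^ 2) - 2 * T * c * c + T * c ^ 2 := by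
    have : (fun s => (T * f s - c) ^ 2) = fun s => T ^ 2 * f s ^ 2 - 2 * T * c * f s + c ^ 2 := by
      funext s; ring
    rw [this, intervalIntegral.integral_add, intervalIntegral.integral_sub,
      intervalIntegral.integral_const_mul, intervalIntegral.integral_const_mul,
      intervalIntegral.integral_const, ← hc]
    · simp
    all_goals exact Continuous.intervalIntegrable (by fun_prop) _ _
  rw [e] at h
  have : 0 ≤ T * (T * (∫ s in (0 : ℝ)..T, f s ^ 2) - c ^ 2) := by nlinarith
  nlinarith [nonneg_of_mul_nonneg_right this hT]

/-- The time integral of a path-continuous process bounded in `L²` is in `L²`, and expectations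
against it may be computed under the integral sign. -/
theorem memLp_intervalIntegral_and_integral_mul {Ω : Type*} [MeasurableSpace Ω] {P : Measure Ω}
    [IsProbabilityMeasure P] {X : ℝ≥0 → Ω → ℝ} (hX : ∀ t, MemLp (X t) 2 P)
    (hc : ∀ᵐ ω ∂P, Continuous fun t => X t ω) {T K : ℝ} (hT : 0 ≤ T)
    (hK : ∀ t : ℝ≥0, t ≤ T → ∫ ω, X t ω ^ 2 ∂P ≤ K) {ψ : ℝ → ℝ} (hψ : Continuous ψ) :
    MemLp (fun ω => ∫ s in (0 : ℝ)..T, ψ s * X s.toNNReal ω) 2 P ∧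
    ∀ Y : Ω → ℝ, MemLp Y 2 P →
      ∫ ω, Y ω * (∫ s in (0 : ℝ)..T, ψ s * X s.toNNReal ω) ∂P
        = ∫ s in (0 : ℝ)..T, ψ s * ∫ ω, Y ω * X s.toNNReal ω ∂P := by
  obtain ⟨Z, hZm, hXZ⟩ := exists_measurable_uncurry_of_ae_continuous
    (fun t => (hX t).aestronglyMeasurable.aemeasurable) hc
  have hXZt : ∀ t, X t =ᵐ[P] Z t := fun t => hXZ.mono fun ω h => h t
  have hZc : ∀ᵐ ω ∂P, Continuous fun t => Z t ω := by
    filter_upwards [hc, hXZ] with ω h1 h2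
    simpa only [← h2] using h1
  let F : ℝ → Ω → ℝ := fun s ω => ψ s * Z s.toNNReal ω
  have hFm : Measurable (Function.uncurry F) := by
    have h1 : Measurable fun p : ℝ × Ω => Z p.1.toNNReal p.2 :=
      hZm.comp (f := fun p : ℝ × Ω => (p.1.toNNReal, p.2)) (by fun_prop)
    exact (hψ.measurable.comp measurable_fst).mul h1
  let μ : Measure ℝ := volume.restrict (Set.uIoc 0 T)
  have : IsFiniteMeasure μ := ⟨by simp [μ, Set.uIoc_of_le hT]⟩
  obtain ⟨R, hR⟩ : ∃ R, ∀ s ∈ Set.uIoc 0 T, ψ s ^ 2 ≤ R := by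
    obtain ⟨R, hR⟩ := (isCompact_Icc (a := (0 : ℝ)) (b := T)).bddAbove_image
      (f := fun s => ψ s ^ 2) (by fun_prop)
    refine ⟨R, fun s hs => hR ⟨s, ?_, rfl⟩⟩
    rw [Set.uIoc_of_le hT] at hs
    exact ⟨hs.1.le, hs.2⟩
  have hFt : ∀ s, MemLp (F s) 2 P := fun s => ((hX _).ae_eq (hXZt _)).const_mul (ψ s)
  have hFsq : Integrable (fun p : ℝ × Ω => Function.uncurry F p ^ 2) (μ.prod P) := by
    rw [integrable_prod_iff (hFm.pow_const 2).aestronglyMeasurable]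
    refine ⟨ae_of_all _ fun s => (hFt s).integrable_sq, ?_⟩
    refine Integrable.of_bound (C := R * K)
      ((hFm.pow_const 2).norm.stronglyMeasurable.integral_prod_right').aestronglyMeasurable ?_
    filter_upwards [ae_restrict_mem measurableSet_uIoc] with s hs
    have h0 : 0 ≤ ∫ ω, X s.toNNReal ω ^ 2 ∂P := integral_nonneg fun ω => sq_nonneg _
    have e : ∫ ω, ‖Function.uncurry F (s, ω) ^ 2‖ ∂P = ψ s ^ 2 * ∫ ω, X s.toNNReal ω ^ 2 ∂P := by
      rw [← integral_const_mul]
      refine integral_congr_ae ?_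
      filter_upwards [hXZt s.toNNReal] with ω h
      simp [F, h, mul_pow]
    rw [e, Real.norm_of_nonneg (by positivity)]
    have hs' := hs
    rw [Set.uIoc_of_le hT] at hs'
    refine mul_le_mul (hR s hs) (hK _ ?_) h0 ((sq_nonneg _).trans (hR s hs))
    rw [Real.coe_toNNReal _ hs'.1.le]
    exact hs'.2
  have hF2 : MemLp (Function.uncurry F) 2 (μ.prod P) :=
    (memLp_two_iff_integrable_sq hFm.aestronglyMeasurable).2 hFsq
  have hI : (fun ω => ∫ s in (0 : ℝ)..T, ψ s * X s.toNNReal ω)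
      =ᵐ[P] fun ω => ∫ s in (0 : ℝ)..T, F s ω := by
    filter_upwards [hXZ] with ω h
    simp only [F, h]
  have hIm : AEStronglyMeasurable (fun ω => ∫ s in (0 : ℝ)..T, F s ω) P := by
    have : (fun ω => ∫ s in (0 : ℝ)..T, F s ω) = fun ω => ∫ s, F s ω ∂μ := by
      funext ω
      simp only [μ, intervalIntegral.integral_of_le hT, Set.uIoc_of_le hT]
    rw [this]
    exact (hFm.stronglyMeasurable.integral_prod_left).aestronglyMeasurable
  constructor
  · refine MemLp.ae_eq hI.symm ((memLp_two_iff_integrable_sq hIm).2 ?_)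
    -- Dominate by `T ∫ F² ds`, which is integrable in `ω` because `F` is square integrable on the
    -- product space.
    refine Integrable.mono' (hFsq.integral_prod_right.const_mul T) (hIm.pow 2) ?_
    filter_upwards [hZc] with ω hω
    have : Continuous fun s => F s ω := hψ.mul (hω.comp continuous_real_toNNReal)
    have h := sq_intervalIntegral_le hT this
    rw [Real.norm_of_nonneg (sq_nonneg _)]
    simpa only [μ, intervalIntegral.integral_of_le hT, Set.uIoc_of_le hT, Function.uncurry_apply_pair]
      using h
  · intro Y hY
    have hYF : Integrable (Function.uncurry fun s ω => Y ω * F s ω) (μ.prod P) :=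
      (hY.comp_snd μ).integrable_mul hF2
    calc ∫ ω, Y ω * (∫ s in (0 : ℝ)..T, ψ s * X s.toNNReal ω) ∂P
        = ∫ ω, (∫ s in (0 : ℝ)..T, Y ω * F s ω) ∂P := by
          refine integral_congr_ae ?_
          filter_upwards [hI] with ω h
          rw [h, intervalIntegral.integral_const_mul]
      _ = ∫ s in (0 : ℝ)..T, ∫ ω, Y ω * F s ω ∂P := (intervalIntegral_integral_swap hYF).symm
      _ = _ := by
          refine intervalIntegral.integral_congr fun s _ => ?_
          rw [← integral_const_mul]
          refine integral_congr_ae ?_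
          filter_upwards [hXZt s.toNNReal] with ω h
          simp only [F, h]
          ring

/-! ### Brownian covariances and the Wiener isometry -/

theorem IsStdBrownian.memLp {k Ω : Type*} [MeasurableSpace Ω] {P : Measure Ω}
    {W : k → ℝ≥0 → Ω → ℝ} (hW : IsStdBrownian W P) (i : k) (t : ℝ≥0) : MemLp (W i t) 2 P :=
  ((hW.brownian i).hasLaw_eval t).hasGaussianLaw.memLp_two

theorem IsStdBrownian.integral_mul {k Ω : Type*} [DecidableEq k] [MeasurableSpace Ω]
    {P : Measure Ω} [IsProbabilityMeasure P] {W : k → ℝ≥0 → Ω → ℝ} (hW : IsStdBrownian W P)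
    (i j : k) (s t : ℝ≥0) :
    ∫ ω, W i s ω * W j t ω ∂P = if i = j then (min s t : ℝ) else 0 := by
  have h := covariance_eq_sub (hW.memLp i s) (hW.memLp j t)
  rw [(hW.brownian i).integral_eval, zero_mul, sub_zero] at h
  simp only [Pi.mul_apply] at h
  rw [← h]
  split_ifs with hij
  · subst hij
    simpa using (hW.brownian i).covariance_eval s t
  · exact ((hW.indep.indepFun hij).comp (measurable_pi_apply s)
      (measurable_pi_apply t)).covariance_eq_zero (hW.memLp i s) (hW.memLp j t)

/-- The antiderivative of `η` obtained by pairing `η(T) δ_T - η' ds` with `min · r`. -/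
theorem mul_sub_integral_deriv_mul_min {η η' : ℝ → ℝ} (hη : ∀ s, HasDerivAt η (η' s) s)
    (hη' : Continuous η') {r T : ℝ} (hr : 0 ≤ r) (hrT : r ≤ T) :
    η T * r - ∫ s in (0 : ℝ)..T, η' s * min s r = ∫ s in (0 : ℝ)..r, η s := by
  have hcont : Continuous η := continuous_iff_continuousAt.2 fun s => (hη s).continuousAt
  have hi : ∀ a b : ℝ, IntervalIntegrable (fun s => η' s * min s r) volume a b := fun a b =>
    Continuous.intervalIntegrable (by fun_prop) _ _
  -- Split at the kink of `min s r`: integrate by parts on the left, where it is `s`; on the right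
  -- it is the constant `r`.
  rw [← intervalIntegral.integral_add_adjacent_intervals (hi 0 r) (hi r T)]
  have h1 : ∫ s in (0 : ℝ)..r, η' s * min s r = η r * r - ∫ s in (0 : ℝ)..r, η s := by
    have e : ∫ s in (0 : ℝ)..r, η' s * min s r = ∫ s in (0 : ℝ)..r, s * η' s := by
      refine intervalIntegral.integral_congr fun s hs => ?_
      rw [Set.uIcc_of_le hr] at hs
      simp only [min_eq_left hs.2, mul_comm]
    rw [e, intervalIntegral.integral_mul_deriv_eq_deriv_mul (u := fun s => s) (u' := fun _ => 1)
      (v := η) (fun s _ => hasDerivAt_id s) (fun s _ => hη s)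
      (continuous_const.intervalIntegrable _ _) (hη'.intervalIntegrable _ _)]
    simp only [one_mul]
    ring
  have h2 : ∫ s in r..T, η' s * min s r = (η T - η r) * r := by
    have e : ∫ s in r..T, η' s * min s r = ∫ s in r..T, η' s * r := by
      refine intervalIntegral.integral_congr fun s hs => ?_
      rw [Set.uIcc_of_le hrT] at hs
      simp only [min_eq_right hs.1]
    rw [e, intervalIntegral.integral_mul_const, intervalIntegral.integral_eq_sub_of_hasDerivAt
      (fun s _ => hη s) (hη'.intervalIntegrable _ _)]
  rw [h1, h2]
  ring

/-- The Wiener integral `∑ᵢ ∫₀ᵀ ηᵢ dWᵢ` of differentiable integrands, written by integration by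
parts as an ordinary integral along the path. -/
noncomputable def wienerIntegral {k Ω : Type*} [Fintype k] (W : k → ℝ≥0 → Ω → ℝ)
    (η η' : k → ℝ → ℝ) (T : ℝ≥0) (ω : Ω) : ℝ :=
  ∑ i, (η i T * W i T ω - ∫ s in (0 : ℝ)..T, η' i s * W i s.toNNReal ω)

theorem IsStdBrownian.integral_sq_le {k Ω : Type*} [MeasurableSpace Ω] {P : Measure Ω}
    [IsProbabilityMeasure P] {W : k → ℝ≥0 → Ω → ℝ} (hW : IsStdBrownian W P) (T : ℝ≥0) (i : k)
    (t : ℝ≥0) (ht : (t : ℝ) ≤ T) : ∫ ω, W i t ω ^ 2 ∂P ≤ T := by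
  classical
  have h := hW.integral_mul i i t t
  simp only [if_true, min_self, ← sq] at h
  rwa [h]

theorem IsStdBrownian.memLp_intervalIntegral {k Ω : Type*} [MeasurableSpace Ω] {P : Measure Ω}
    [IsProbabilityMeasure P] {W : k → ℝ≥0 → Ω → ℝ} {η' : k → ℝ → ℝ} (hW : IsStdBrownian W P)
    (hη' : ∀ i, Continuous (η' i)) (T : ℝ≥0) (i : k) :
    MemLp (fun ω => ∫ s in (0 : ℝ)..T, η' i s * W i s.toNNReal ω) 2 P :=
  (memLp_intervalIntegral_and_integral_mul (hW.memLp i) (hW.brownian i).cont T.coe_nonneg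
    (hW.integral_sq_le T i) (hη' i)).1

section Wiener

variable {k Ω : Type*} [Fintype k] [MeasurableSpace Ω] {P : Measure Ω} [IsProbabilityMeasure P]
  {W : k → ℝ≥0 → Ω → ℝ} {η η' : k → ℝ → ℝ}

theorem memLp_wienerIntegral (hW : IsStdBrownian W P) (hη' : ∀ i, Continuous (η' i)) (T : ℝ≥0) :
    MemLp (wienerIntegral W η η' T) 2 P :=
  memLp_finsetSum _ fun i _ =>
    ((hW.memLp i T).const_mul (η i T)).sub (hW.memLp_intervalIntegral hη' T i)

/-- Fubini reduces pairing with a Wiener integral to pairing with `W` at deterministic times. This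
is used with `Y` a Brownian coordinate, and then with `Y` the Wiener integral itself. -/
theorem integral_mul_wienerIntegral (hW : IsStdBrownian W P) (hη' : ∀ i, Continuous (η' i))
    (T : ℝ≥0) {Y : Ω → ℝ} (hY : MemLp Y 2 P) :
    ∫ ω, Y ω * wienerIntegral W η η' T ω ∂P = ∑ i, (η i T * (∫ ω, Y ω * W i T ω ∂P)
      - ∫ s in (0 : ℝ)..T, η' i s * ∫ ω, Y ω * W i s.toNNReal ω ∂P) := by
  have h1 : ∀ i, Integrable (fun ω => Y ω * (η i T * W i T ω)) P := fun i =>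
    hY.integrable_mul ((hW.memLp i T).const_mul (η i T))
  have h2 : ∀ i, Integrable
      (fun ω => Y ω * ∫ s in (0 : ℝ)..T, η' i s * W i s.toNNReal ω) P := fun i =>
    hY.integrable_mul (hW.memLp_intervalIntegral hη' T i)
  simp only [wienerIntegral, Finset.mul_sum, mul_sub]
  rw [integral_finsetSum _ fun i _ => by exact (h1 i).sub (h2 i)]
  refine Finset.sum_congr rfl fun i _ => ?_
  rw [integral_sub (h1 i) (h2 i), (memLp_intervalIntegral_and_integral_mul (hW.memLp i)
    (hW.brownian i).cont T.coe_nonneg (hW.integral_sq_le T i) (hη' i)).2 Y hY, ← integral_const_mul]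
  simp only [mul_left_comm]

/-- Independence removes all coordinates but `j`. The covariance `min s r` then tests `η` against
the indicator of `[0, r]`, by `mul_sub_integral_deriv_mul_min`. -/
theorem integral_brownian_mul_wienerIntegral (hW : IsStdBrownian W P)
    (hη : ∀ i s, HasDerivAt (η i) (η' i s) s) (hη' : ∀ i, Continuous (η' i)) {T r : ℝ≥0}
    (hr : r ≤ T) (j : k) :
    ∫ ω, W j r ω * wienerIntegral W η η' T ω ∂P = ∫ s in (0 : ℝ)..r, η j s := by
  classical
  rw [integral_mul_wienerIntegral hW hη' T (hW.memLp j r), Finset.sum_eq_single j]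
  · simp only [hW.integral_mul, if_true]
    rw [← mul_sub_integral_deriv_mul_min (hη j) (hη' j) r.coe_nonneg (by exact_mod_cast hr),
      min_eq_left (by exact_mod_cast hr)]
    congr 1
    refine intervalIntegral.integral_congr fun s hs => ?_
    rw [Set.uIcc_of_le T.coe_nonneg] at hs
    simp only [Real.coe_toNNReal _ hs.1, min_comm]
  · intro i _ hij
    simp [hW.integral_mul, hij.symm]
  · simp

/-- **Wiener isometry.** -/
theorem integral_wienerIntegral_sq (hW : IsStdBrownian W P)
    (hη : ∀ i s, HasDerivAt (η i) (η' i s) s) (hη' : ∀ i, Continuous (η' i)) (T : ℝ≥0) :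
    ∫ ω, wienerIntegral W η η' T ω ^ 2 ∂P = ∑ i, ∫ s in (0 : ℝ)..T, η i s ^ 2 := by
  simp only [sq]
  rw [integral_mul_wienerIntegral hW hη' T (memLp_wienerIntegral hW hη' T)]
  refine Finset.sum_congr rfl fun i _ => ?_
  have hcont : Continuous (η i) := continuous_iff_continuousAt.2 fun s => (hη i s).continuousAt
  simp only [mul_comm (wienerIntegral W η η' T _)]
  rw [integral_brownian_mul_wienerIntegral hW hη hη' le_rfl]
  have e : ∫ s in (0 : ℝ)..T, η' i s * ∫ ω, W i s.toNNReal ω * wienerIntegral W η η' T ω ∂P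
      = ∫ s in (0 : ℝ)..T, η' i s * ∫ u in (0 : ℝ)..s, η i u := by
    refine intervalIntegral.integral_congr fun s hs => ?_
    rw [Set.uIcc_of_le T.coe_nonneg] at hs
    rw [integral_brownian_mul_wienerIntegral hW hη hη' (Real.toNNReal_le_iff_le_coe.2 hs.2),
      Real.coe_toNNReal _ hs.1]
  -- Integration by parts against the primitive of `η` cancels the boundary term and leaves `∫ η²`.
  rw [e, intervalIntegral.integral_mul_deriv_eq_deriv_mul (u := η i) (u' := η' i)
    (v := fun s => ∫ u in (0 : ℝ)..s, η i u) (fun s _ => hη i s)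
    (fun s _ => hcont.integral_hasStrictDerivAt 0 s |>.hasDerivAt)
    ((hη' i).intervalIntegrable _ _) (hcont.intervalIntegrable _ _)]
  simp

end Wiener

/-! ### Linear systems: Lyapunov equation, variation of constants, output variance -/

section LinearSystem

variable {n k p : Type*} [Fintype n] [DecidableEq n]

theorem mul_exp_smul_comm (A : Matrix n n ℝ) (t : ℝ) :
    A * NormedSpace.exp (t • A) = NormedSpace.exp (t • A) * A := by
  open scoped Norms.Operator in
  exact ((Commute.refl A).smul_right t).exp_right

/-- Working entrywise keeps the statement independent of any norm on matrices. -/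
theorem hasDerivAt_mul_exp_mul_apply (A : Matrix n n ℝ) (C : Matrix p n ℝ) (B : Matrix n k ℝ)
    (t : ℝ) (i : p) (j : k) :
    HasDerivAt (fun t : ℝ => (C * NormedSpace.exp (t • A) * B) i j)
      ((C * NormedSpace.exp (t • A) * A * B) i j) t := by
  open scoped Norms.Operator in
  let L : Matrix n n ℝ →ₗ[ℝ] ℝ :=
    { toFun := fun X => (C * X * B) i j
      map_add' := fun X Y => by simp [Matrix.mul_add, Matrix.add_mul]
      map_smul' := fun c X => by simp }
  have h := L.toContinuousLinearMap.hasFDerivAt.comp_hasDerivAt t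
    (hasDerivAt_exp_smul_const (𝕂 := ℝ) A t)
  have e : C * NormedSpace.exp (t • A) * A * B = C * (NormedSpace.exp (t • A) * A) * B := by
    simp only [Matrix.mul_assoc]
  rw [e]
  exact h

theorem hasDerivAt_mul_exp_apply (A : Matrix n n ℝ) (C : Matrix p n ℝ) (t : ℝ) (i : p) (j : n) :
    HasDerivAt (fun t : ℝ => (C * NormedSpace.exp (t • A)) i j)
      ((C * NormedSpace.exp (t • A) * A) i j) t := by
  simpa using hasDerivAt_mul_exp_mul_apply A C 1 t i j

theorem continuous_mul_exp_mul_apply (A : Matrix n n ℝ) (C : Matrix p n ℝ) (B : Matrix n k ℝ)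
    (i : p) (j : k) : Continuous fun t : ℝ => (C * NormedSpace.exp (t • A) * B) i j :=
  continuous_iff_continuousAt.2 fun t => (hasDerivAt_mul_exp_mul_apply A C B t i j).continuousAt

theorem trace_transpose_mul_self_eq_sum [Fintype k] [Fintype p] (X : Matrix p k ℝ) :
    (Xᵀ * X).trace = ∑ i, ∑ j, X i j ^ 2 := by
  simp only [trace, diag_apply, mul_apply, transpose_apply, sq]
  exact Finset.sum_comm

/-- A matrix `P` that solves the Lyapunov equation `A P + P Aᵀ + B Bᵀ = 0` up to a term which is
not seen by the output computes the squared `H₂` norm of an output-stable system. -/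
theorem hasH2NormSq_of_lyapunov [Fintype k] [Fintype p] {A P : Matrix n n ℝ} {B : Matrix n k ℝ}
    {C : Matrix p n ℝ}
    (hC : ∀ i j, Tendsto (fun t : ℝ => (C * NormedSpace.exp (t • A)) i j) atTop (𝓝 0))
    (hP : ∀ t : ℝ, (C * NormedSpace.exp (t • A)) * (A * P + P * Aᵀ + B * Bᵀ)
      * (C * NormedSpace.exp (t • A))ᵀ = 0) :
    HasH2NormSq A B C (C * P * Cᵀ).trace := by
  let X : ℝ → Matrix p n ℝ := fun t => C * NormedSpace.exp (t • A)
  have htr : ∀ Y Z : Matrix p n ℝ, (Y * Zᵀ).trace = ∑ i, ∑ j, Y i j * Z i j := fun Y Z => by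
    simp only [trace, diag_apply, mul_apply, transpose_apply]
  -- The derivative is `-Tr(X (AP + PAᵀ) Xᵀ)`, which `hP` turns into `Tr(X BBᵀ Xᵀ)`.
  have hder : ∀ t, HasDerivAt (fun t => -(X t * P * (X t)ᵀ).trace)
      (((impulseResponse A B C t)ᵀ * impulseResponse A B C t).trace) t := by
    intro t
    have h : HasDerivAt (fun t => -(X t * P * (X t)ᵀ).trace)
        (-((X t * A * P * (X t)ᵀ).trace + (X t * P * (X t * A)ᵀ).trace)) t := by
      simp only [htr, ← Finset.sum_add_distrib]
      refine (HasDerivAt.fun_sum fun i _ => HasDerivAt.fun_sum fun j _ => ?_).neg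
      exact (hasDerivAt_mul_exp_mul_apply A C P t i j).mul (hasDerivAt_mul_exp_apply A C t i j)
    convert h using 1
    have h0 : (X t * A * P * (X t)ᵀ) + (X t * P * (X t * A)ᵀ) + (X t * B) * (X t * B)ᵀ = 0 := by
      rw [← hP t]
      simp only [transpose_mul, Matrix.mul_add, Matrix.add_mul, Matrix.mul_assoc, X]
    have h1 := congrArg trace h0
    rw [trace_add, trace_add, trace_zero] at h1
    rw [trace_mul_comm (X t * B)] at h1
    exact eq_neg_of_add_eq_zero_right h1
  have hlim : Tendsto (fun t => -(X t * P * (X t)ᵀ).trace) atTop (𝓝 0) := by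
    have : Tendsto (fun t => -∑ i, ∑ j, (∑ l, X t i l * P l j) * X t i j) atTop
        (𝓝 (-∑ i : p, ∑ j : n, (∑ l, 0 * P l j) * 0)) :=
      (tendsto_finsetSum _ fun i _ => tendsto_finsetSum _ fun j _ =>
        (tendsto_finsetSum _ fun l _ => (hC i l).mul_const _).mul (hC i j)).neg
    simpa only [htr, mul_apply, mul_zero, Finset.sum_const_zero, neg_zero] using this
  have hnn : ∀ t ∈ Set.Ioi (0 : ℝ),
      0 ≤ ((impulseResponse A B C t)ᵀ * impulseResponse A B C t).trace := fun t _ => by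
    rw [trace_transpose_mul_self_eq_sum]
    positivity
  refine ⟨integrableOn_Ioi_deriv_of_nonneg' (fun t _ => hder t) hnn hlim, ?_⟩
  rw [integral_Ioi_of_hasDerivAt_of_nonneg' (fun t _ => hder t) hnn hlim]
  simp [X, NormedSpace.exp_zero]

/-- **Variation of constants** for `dx = A x dt + B df` with a merely continuous input `f`. -/
theorem mulVec_eq_of_integral_equation [Fintype k] {A : Matrix n n ℝ} {B : Matrix n k ℝ}
    (C : Matrix p n ℝ) {x : ℝ≥0 → n → ℝ} {f : ℝ≥0 → k → ℝ} (hx : Continuous x)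
    (hf : ∀ i, Continuous fun t => f t i)
    (h : ∀ t : ℝ≥0, x t = x 0 + (∫ s in (0 : ℝ)..t, A *ᵥ x s.toNNReal) + B *ᵥ f t)
    (T : ℝ≥0) (q : p) :
    (C *ᵥ x T) q = ((C * NormedSpace.exp ((T : ℝ) • A)) *ᵥ x 0) q
      + ∑ i, ((C * NormedSpace.exp (((T : ℝ) - T) • A) * B) q i * f T i
        - ∫ s in (0 : ℝ)..T, -(C * NormedSpace.exp (((T : ℝ) - s) • A) * A * B) q i
          * f s.toNNReal i) := by
  let X : ℝ → n → ℝ := fun s => x s.toNNReal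
  have hX : Continuous X := hx.comp continuous_real_toNNReal
  have hAX : Continuous fun s => A *ᵥ X s := by fun_prop
  -- `Z = x - Bf` is differentiable although `x` and `f` need not be, so the product rule applies to
  -- `E(s) Z(s)`; its derivative is `E A (x - Z) = E A B f`.
  let Z : ℝ → n → ℝ := fun t => x 0 + ∫ s in (0 : ℝ)..t, A *ᵥ X s
  have hZ : ∀ t, HasDerivAt Z (A *ᵥ X t) t := fun t =>
    (hAX.integral_hasStrictDerivAt 0 t).hasDerivAt.const_add (x 0)
  have hXZ : ∀ t : ℝ≥0, x t = Z t + B *ᵥ f t := h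
  let E : ℝ → Matrix p n ℝ := fun s => C * NormedSpace.exp (((T : ℝ) - s) • A)
  have hE : ∀ s j, HasDerivAt (fun s => E s q j) (-(E s * A) q j) s := by
    intro s j
    have h1 := (hasDerivAt_mul_exp_apply A C ((T : ℝ) - s) q j).comp s
      ((hasDerivAt_id s).const_sub (T : ℝ))
    simpa [E, Function.comp_def] using h1
  have hF : ∀ s, HasDerivAt (fun s => (E s *ᵥ Z s) q) (((E s * A) *ᵥ (X s - Z s)) q) s := by
    intro s
    have h1 : HasDerivAt (fun s => ∑ j, E s q j * Z s j)
        (∑ j, (-(E s * A) q j * Z s j + E s q j * (A *ᵥ X s) j)) s :=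
      HasDerivAt.fun_sum fun j _ => (hE s j).mul (hasDerivAt_pi.1 (hZ s) j)
    have e : ((E s * A) *ᵥ (X s - Z s)) q
        = ∑ j, (-(E s * A) q j * Z s j + E s q j * (A *ᵥ X s) j) := by
      have e' : (E s * A) *ᵥ X s = E s *ᵥ (A *ᵥ X s) := (mulVec_mulVec _ _ _).symm
      rw [mulVec_sub, e']
      simp only [Pi.sub_apply, Finset.sum_add_distrib, neg_mul, Finset.sum_neg_distrib]
      rw [sub_eq_neg_add]
      rfl
    rw [e]
    exact h1
  have hcont : ∀ i, Continuous fun s : ℝ => (E s * A * B) q i * f s.toNNReal i := fun i => by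
    refine Continuous.mul ?_ ((hf i).comp continuous_real_toNNReal)
    have := (continuous_mul_exp_mul_apply A C (A * B) q i).comp (continuous_const.sub continuous_id
      : Continuous fun s : ℝ => (T : ℝ) - s)
    simpa [E, Function.comp_def, Matrix.mul_assoc] using this
  have hFW : ∀ s ∈ Set.uIcc (0 : ℝ) T, HasDerivAt (fun s => (E s *ᵥ Z s) q)
      (∑ i, (E s * A * B) q i * f s.toNNReal i) s := by
    intro s hs
    rw [Set.uIcc_of_le T.coe_nonneg] at hs
    convert hF s using 1
    have h1 := hXZ s.toNNReal
    rw [Real.coe_toNNReal _ hs.1] at h1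
    have h2 : X s - Z s = B *ᵥ f s.toNNReal := by
      simp only [X]
      rw [h1, add_sub_cancel_left]
    rw [h2, mulVec_mulVec]
    rfl
  have hint := intervalIntegral.integral_eq_sub_of_hasDerivAt hFW
    ((continuous_finsetSum _ fun i _ => hcont i).intervalIntegrable _ _)
  rw [intervalIntegral.integral_finsetSum fun i _ => (hcont i).intervalIntegrable _ _] at hint
  have hZ0 : Z 0 = x 0 := by simp [Z]
  have hET : E T = C := by simp [E, NormedSpace.exp_zero]
  have hE0 : E 0 = C * NormedSpace.exp ((T : ℝ) • A) := by simp [E]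
  rw [hET, hE0, hZ0] at hint
  have h3 : (C *ᵥ x T) q = (C *ᵥ Z T) q + ((C * B) *ᵥ f T) q := by
    rw [hXZ T, mulVec_add, mulVec_mulVec]
    rfl
  have h4 : ((C * B) *ᵥ f T) q = ∑ i, (E T * B) q i * f T i := by
    rw [hET]
    rfl
  simp only [neg_mul, intervalIntegral.integral_neg, sub_neg_eq_add, Finset.sum_add_distrib]
  rw [h3, h4]
  simp only [E] at hint ⊢
  linarith

/-- An output-stable system with finite `H₂` norm has steady-state output variance equal to the
squared `H₂` norm. -/
theorem HasH2NormSq.hasSteadyStateVariance [Fintype k] [Fintype p] {A : Matrix n n ℝ}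
    {B : Matrix n k ℝ} {C : Matrix p n ℝ} {h : ℝ} (hH : HasH2NormSq A B C h)
    (hC : ∀ i j, Tendsto (fun t : ℝ => (C * NormedSpace.exp (t • A)) i j) atTop (𝓝 0)) :
    HasSteadyStateVariance.{u} A B C h := by
  intro Ω _ P _ W x hW hx hx0
  let η : ℝ≥0 → p → k → ℝ → ℝ := fun T q i s => (C * NormedSpace.exp (((T : ℝ) - s) • A) * B) q i
  let η' : ℝ≥0 → p → k → ℝ → ℝ := fun T q i s =>
    -(C * NormedSpace.exp (((T : ℝ) - s) • A) * A * B) q i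
  have hη : ∀ T q i s, HasDerivAt (η T q i) (η' T q i s) s := fun T q i s => by
    have h1 := (hasDerivAt_mul_exp_mul_apply A C B ((T : ℝ) - s) q i).comp s
      ((hasDerivAt_id s).const_sub (T : ℝ))
    simpa [η, η', Function.comp_def] using h1
  have hη' : ∀ T q i, Continuous (η' T q i) := fun T q i => by
    have := ((continuous_mul_exp_mul_apply A C (A * B) q i).comp
      (continuous_const.sub continuous_id : Continuous fun s : ℝ => (T : ℝ) - s)).neg
    simp only [η', Matrix.mul_assoc _ A B]
    exact this
  let g : ℝ≥0 → p → Ω → ℝ := fun T q => wienerIntegral W (η T q) (η' T q) T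
  let c : ℝ≥0 → p → n → ℝ := fun T q j => (C * NormedSpace.exp ((T : ℝ) • A)) q j
  let a : ℝ≥0 → p → Ω → ℝ := fun T q ω => ∑ j, c T q j * x 0 ω j
  have hxj : ∀ j, MemLp (fun ω => x 0 ω j) 2 P := fun j => hx0.eval j
  have hg : ∀ T q, MemLp (g T q) 2 P := fun T q => memLp_wienerIntegral hW (hη' T q) T
  have ha : ∀ T q, MemLp (a T q) 2 P := fun T q =>
    memLp_finsetSum _ fun j _ => (hxj j).const_mul (c T q j)
  have hy : ∀ᵐ ω ∂P, ∀ T q, (C *ᵥ x T ω) q = a T q ω + g T q ω := by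
    have hWc : ∀ᵐ ω ∂P, ∀ i, Continuous fun t => W i t ω :=
      ae_all_iff.2 fun i => (hW.brownian i).cont
    filter_upwards [hx, hWc] with ω hω hWω T q
    exact mulVec_eq_of_integral_equation C (f := fun t i => W i t ω) hω.1 hWω hω.2 T q
  -- Group `(a + g)²` as `a (a + 2g) + g²`: the first part has the decaying factor `C exp(TA)`, the
  -- second is pure noise.
  have hyy : ∀ T, (fun ω => (C *ᵥ x T ω) ⬝ᵥ (C *ᵥ x T ω))
      =ᵐ[P] fun ω => ∑ q, (a T q ω * (a T q ω + 2 * g T q ω) + g T q ω ^ 2) := fun T => by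
    filter_upwards [hy] with ω hω
    refine Finset.sum_congr rfl fun q _ => ?_
    rw [hω]
    ring
  have hi1 : ∀ T q, Integrable (fun ω => a T q ω * (a T q ω + 2 * g T q ω)) P := fun T q =>
    (ha T q).integrable_mul ((ha T q).add ((hg T q).const_mul 2))
  have hi2 : ∀ T q, Integrable (fun ω => g T q ω ^ 2) P := fun T q => (hg T q).integrable_sq
  refine ⟨fun T => (integrable_finsetSum _ fun q _ => (hi1 T q).add (hi2 T q)).congr (hyy T).symm,
    ?_⟩
  -- Isometry, then the substitution `s ↦ T - s`.
  have hgsq : ∀ T q, ∫ ω, g T q ω ^ 2 ∂P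
      = ∑ i, ∫ s in (0 : ℝ)..T, impulseResponse A B C s q i ^ 2 := by
    intro T q
    rw [integral_wienerIntegral_sq hW (hη T q) (hη' T q)]
    refine Finset.sum_congr rfl fun i _ => ?_
    simpa [η, impulseResponse] using intervalIntegral.integral_comp_sub_left (a := 0) (b := (T : ℝ))
      (fun s => impulseResponse A B C s q i ^ 2) (T : ℝ)
  have hgsum : ∀ T, ∑ q, ∫ ω, g T q ω ^ 2 ∂P = ∫ s in (0 : ℝ)..T,
      ((impulseResponse A B C s)ᵀ * impulseResponse A B C s).trace := by
    intro T
    have hcont : ∀ q i, Continuous fun s : ℝ => impulseResponse A B C s q i ^ 2 := fun q i =>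
      (continuous_mul_exp_mul_apply A C B q i).pow 2
    simp only [hgsq, trace_transpose_mul_self_eq_sum]
    rw [intervalIntegral.integral_finsetSum fun q _ =>
      (continuous_finsetSum _ fun i _ => hcont q i).intervalIntegrable _ _]
    refine Finset.sum_congr rfl fun q _ => ?_
    rw [intervalIntegral.integral_finsetSum fun i _ => (hcont q i).intervalIntegrable _ _]
  have hlim : Tendsto (fun T : ℝ≥0 => ∑ q, ∫ ω, g T q ω ^ 2 ∂P) atTop (𝓝 h) := by
    simp only [hgsum]
    rw [← hH.2]
    exact intervalIntegral_tendsto_integral_Ioi 0 hH.1 (NNReal.tendsto_coe_atTop.2 tendsto_id)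
  have hcz : ∀ q j, Tendsto (fun T => c T q j) atTop (𝓝 0) := fun q j =>
    (hC q j).comp (NNReal.tendsto_coe_atTop.2 tendsto_id)
  -- The initial state is not assumed independent of the noise, so the cross term need not be zero.
  -- Boundedness suffices, and follows from `2|xg| ≤ x² + g²` and convergence of `E|g|²`.
  have hbd : ∀ q j, IsBoundedUnder (· ≤ ·) atTop
      (norm ∘ fun T => ∫ ω, x 0 ω j * (a T q ω + 2 * g T q ω) ∂P) := by
    intro q j
    have hl : Tendsto (fun T => |∑ l, c T q l * ∫ ω, x 0 ω j * x 0 ω l ∂P|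
        + ((∫ ω, x 0 ω j ^ 2 ∂P) + ∑ q, ∫ ω, g T q ω ^ 2 ∂P)) atTop
        (𝓝 (|∑ l : n, 0 * ∫ ω, x 0 ω j * x 0 ω l ∂P| + ((∫ ω, x 0 ω j ^ 2 ∂P) + h))) :=
      (tendsto_finsetSum _ fun l _ => (hcz q l).mul_const _).abs.add (hlim.const_add _)
    refine hl.isBoundedUnder_le.mono_le (Eventually.of_forall fun T => ?_)
    have i1 : ∀ l, Integrable (fun ω => c T q l * (x 0 ω j * x 0 ω l)) P := fun l =>
      ((hxj j).integrable_mul (hxj l)).const_mul _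
    have i2 : Integrable (fun ω => 2 * (x 0 ω j * g T q ω)) P :=
      ((hxj j).integrable_mul (hg T q)).const_mul 2
    have e : ∫ ω, x 0 ω j * (a T q ω + 2 * g T q ω) ∂P
        = (∑ l, c T q l * ∫ ω, x 0 ω j * x 0 ω l ∂P) + ∫ ω, 2 * (x 0 ω j * g T q ω) ∂P := by
      simp only [← integral_const_mul (μ := P) (c T q _)]
      rw [← integral_finsetSum _ fun l _ => i1 l,
        ← integral_add (integrable_finsetSum _ fun l _ => i1 l) i2]
      refine integral_congr_ae (ae_of_all _ fun ω => ?_)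
      simp only [a, mul_add, Finset.mul_sum]
      congr 1
      · exact Finset.sum_congr rfl fun l _ => by ring
      · ring
    have hle : |∫ ω, 2 * (x 0 ω j * g T q ω) ∂P|
        ≤ (∫ ω, x 0 ω j ^ 2 ∂P) + ∫ ω, g T q ω ^ 2 ∂P := by
      rw [← integral_add (hxj j).integrable_sq (hi2 T q)]
      refine (abs_integral_le_integral_abs).trans
        (integral_mono i2.abs ((hxj j).integrable_sq.add (hi2 T q)) fun ω => ?_)
      simp only
      rw [abs_le]
      constructor <;> nlinarith [sq_nonneg (x 0 ω j + g T q ω), sq_nonneg (x 0 ω j - g T q ω)]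
    have hq : ∫ ω, g T q ω ^ 2 ∂P ≤ ∑ q, ∫ ω, g T q ω ^ 2 ∂P :=
      Finset.single_le_sum (f := fun q => ∫ ω, g T q ω ^ 2 ∂P)
        (fun q _ => integral_nonneg fun ω => sq_nonneg _) (Finset.mem_univ q)
    simp only [Function.comp_apply, Real.norm_eq_abs]
    rw [e]
    refine (abs_add_le _ _).trans ?_
    linarith
  have hcross : ∀ q, Tendsto (fun T => ∫ ω, a T q ω * (a T q ω + 2 * g T q ω) ∂P) atTop (𝓝 0) := by
    intro q
    have e : ∀ T, ∫ ω, a T q ω * (a T q ω + 2 * g T q ω) ∂P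
        = ∑ j, c T q j * ∫ ω, x 0 ω j * (a T q ω + 2 * g T q ω) ∂P := by
      intro T
      have hj : ∀ j, Integrable (fun ω => x 0 ω j * (a T q ω + 2 * g T q ω)) P := fun j =>
        (hxj j).integrable_mul ((ha T q).add ((hg T q).const_mul 2))
      simp only [← integral_const_mul]
      rw [← integral_finsetSum _ fun j _ => (hj j).const_mul _]
      refine integral_congr_ae (ae_of_all _ fun ω => ?_)
      conv_lhs => simp only [a]
      rw [Finset.sum_mul]
      simp only [a, mul_assoc]
    simp only [e]
    simpa using tendsto_finsetSum Finset.univ fun j _ =>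
      (hcz q j).zero_mul_isBoundedUnder_le (hbd q j)
  have hE : ∀ T, ∫ ω, (C *ᵥ x T ω) ⬝ᵥ (C *ᵥ x T ω) ∂P
      = ∑ q, ∫ ω, a T q ω * (a T q ω + 2 * g T q ω) ∂P + ∑ q, ∫ ω, g T q ω ^ 2 ∂P := by
    intro T
    rw [integral_congr_ae (hyy T), integral_finsetSum _ fun q _ => by exact (hi1 T q).add (hi2 T q),
      ← Finset.sum_add_distrib]
    exact Finset.sum_congr rfl fun q _ => integral_add (hi1 T q) (hi2 T q)
  simp only [hE]
  simpa using (tendsto_finsetSum Finset.univ fun q _ => hcross q).add hlim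

end LinearSystem

/-! ### Weighted Laplacians and their quadratic form -/

section Laplacian

variable {V : Type*} [Fintype V] [DecidableEq V] (G : SimpleGraph V) [DecidableRel G.Adj]
  {w : V → V → ℝ}

theorem weightedLaplacian_mulVec (w : V → V → ℝ) (v : V → ℝ) (i : V) :
    (weightedLaplacian G w *ᵥ v) i = ∑ j, (if G.Adj i j then w i j else 0) * (v i - v j) := by
  have h : ∀ j, weightedLaplacian G w i j * v j
      = (if i = j then (∑ l, if G.Adj i l then w i l else 0) * v j else 0)
        - (if G.Adj i j then w i j else 0) * v j := by
    intro j
    by_cases hij : i = j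
    · subst hij
      simp [weightedLaplacian]
    · by_cases ha : G.Adj i j <;> simp [weightedLaplacian, hij, ha]
  simp only [mulVec, dotProduct, h, Finset.sum_sub_distrib, mul_sub, Finset.sum_mul]
  simp

/-- Average the double sum with its copy under `i ↔ j`; the half reflects that each edge occurs as
two ordered pairs. -/
theorem dotProduct_weightedLaplacian_mulVec (hw : ∀ i j, w i j = w j i) (v : V → ℝ) :
    v ⬝ᵥ (weightedLaplacian G w *ᵥ v)
      = (∑ i, ∑ j, (if G.Adj i j then w i j else 0) * (v i - v j) ^ 2) / 2 := by
  have h1 : v ⬝ᵥ (weightedLaplacian G w *ᵥ v)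
      = ∑ i, ∑ j, (if G.Adj i j then w i j else 0) * (v i * (v i - v j)) := by
    simp only [dotProduct, weightedLaplacian_mulVec, Finset.mul_sum]
    exact Finset.sum_congr rfl fun i _ => Finset.sum_congr rfl fun j _ => by ring
  have h2 : v ⬝ᵥ (weightedLaplacian G w *ᵥ v)
      = ∑ i, ∑ j, (if G.Adj i j then w i j else 0) * (v j * (v j - v i)) := by
    rw [h1, Finset.sum_comm]
    simp only [G.adj_comm, hw]
  have h3 : ∑ i, ∑ j, (if G.Adj i j then w i j else 0) * (v i - v j) ^ 2
      = v ⬝ᵥ (weightedLaplacian G w *ᵥ v) + v ⬝ᵥ (weightedLaplacian G w *ᵥ v) := by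
    nth_rewrite 1 [h1]
    rw [h2]
    simp only [← Finset.sum_add_distrib]
    exact Finset.sum_congr rfl fun i _ => Finset.sum_congr rfl fun j _ => by ring
  linarith

theorem weightedLaplacian_transpose (hw : ∀ i j, w i j = w j i) :
    (weightedLaplacian G w)ᵀ = weightedLaplacian G w := by
  ext i j
  by_cases hij : i = j
  · subst hij
    rfl
  · simp [weightedLaplacian, hij, Ne.symm hij, G.adj_comm j i, hw j i]

theorem weightedLaplacian_quadratic_nonneg (hw : ∀ i j, w i j = w j i)
    (hw0 : ∀ i j, G.Adj i j → 0 ≤ w i j) (v : V → ℝ) :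
    0 ≤ v ⬝ᵥ (weightedLaplacian G w *ᵥ v) := by
  rw [dotProduct_weightedLaplacian_mulVec G hw]
  refine div_nonneg (Finset.sum_nonneg fun i _ => Finset.sum_nonneg fun j _ =>
    mul_nonneg ?_ (sq_nonneg _)) zero_le_two
  split_ifs with h
  exacts [hw0 i j h, le_rfl]

theorem weightedLaplacian_posSemidef (hw : ∀ i j, w i j = w j i)
    (hw0 : ∀ i j, G.Adj i j → 0 ≤ w i j) : (weightedLaplacian G w).PosSemidef := by
  refine PosSemidef.of_dotProduct_mulVec_nonneg ?_ fun v => ?_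
  · rw [IsHermitian, conjTranspose_eq_transpose_of_trivial, weightedLaplacian_transpose G hw]
  · simpa using weightedLaplacian_quadratic_nonneg G hw hw0 v

variable {G} in
/-- Along the edges of a walk the Laplacian form controls the difference of the end values. -/
theorem exists_sq_sub_le_of_walk (hw : ∀ i j, w i j = w j i)
    (hw0 : ∀ i j, G.Adj i j → 0 < w i j) {i j : V} (p : G.Walk i j) :
    ∃ K : ℝ, ∀ v : V → ℝ, (v i - v j) ^ 2 ≤ K * (v ⬝ᵥ (weightedLaplacian G w *ᵥ v)) := by
  induction p with
  | nil => exact ⟨0, fun v => by simp⟩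
  | @cons a c e h p ih =>
    obtain ⟨K, hK⟩ := ih
    -- From `(x + y)² ≤ 2x² + 2y²`: the first edge contributes `2 / w a c`, as one ordered pair in
    -- twice the form, and the rest of the walk contributes `K`.
    refine ⟨2 * (2 / w a c) + 2 * K, fun v => ?_⟩
    have hpos := hw0 a c h
    have hnn : ∀ i j, 0 ≤ (if G.Adj i j then w i j else 0) * (v i - v j) ^ 2 := fun i j => by
      refine mul_nonneg ?_ (sq_nonneg _)
      split_ifs with h
      exacts [(hw0 i j h).le, le_rfl]
    have h1 : w a c * (v a - v c) ^ 2 ≤ 2 * (v ⬝ᵥ (weightedLaplacian G w *ᵥ v)) := by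
      rw [dotProduct_weightedLaplacian_mulVec G hw]
      have h2 := Finset.single_le_sum (f := fun j => (if G.Adj a j then w a j else 0)
        * (v a - v j) ^ 2) (fun j _ => hnn a j) (Finset.mem_univ c)
      have h3 := Finset.single_le_sum (f := fun i => ∑ j, (if G.Adj i j then w i j else 0)
        * (v i - v j) ^ 2) (fun i _ => Finset.sum_nonneg fun j _ => hnn i j) (Finset.mem_univ a)
      simp only [h, if_true] at h2 h3
      linarith
    have h4 : (v a - v c) ^ 2 ≤ 2 / w a c * (v ⬝ᵥ (weightedLaplacian G w *ᵥ v)) := by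
      rw [div_mul_eq_mul_div, le_div_iff₀ hpos]
      linarith
    have h5 := hK v
    nlinarith [sq_nonneg ((v a - v c) - (v c - v e))]

end Laplacian

/-! ### Energy decay of damped second-order systems -/

/-- The energy of a damped second-order system `m θ'' + d θ' + L θ = 0` with `L` symmetric positive
semidefinite tends to zero. -/
theorem tendsto_energy_zero {V : Type*} [Fintype V] {L : Matrix V V ℝ} (hL : Lᵀ = L)
    (hL0 : ∀ v, 0 ≤ v ⬝ᵥ (L *ᵥ v)) {m : V → ℝ} (hm : ∀ i, 0 < m i) {d : ℝ} (hd : 0 < d)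
    {θ ω : ℝ → V → ℝ} (hθ : ∀ t i, HasDerivAt (fun t => θ t i) (ω t i) t)
    (hω : ∀ t i, HasDerivAt (fun t => ω t i) (-((L *ᵥ θ t) i + d * ω t i) / m i) t) :
    Tendsto (fun t => ∑ i, m i * ω t i ^ 2 + θ t ⬝ᵥ (L *ᵥ θ t)) atTop (𝓝 0) := by
  let H : ℝ → ℝ := fun t => ∑ i, m i * ω t i ^ 2 + θ t ⬝ᵥ (L *ᵥ θ t)
  -- `H` dissipates only through `ω`. The term `dθ²` is chosen to cancel the damping in the
  -- derivative of `2mθω`, so that `R' = 2 ∑ mω² - 2 θᵀLθ` supplies the missing decay of the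
  -- potential energy.
  let R : ℝ → ℝ := fun t => ∑ i, (2 * m i * (θ t i * ω t i) + d * θ t i ^ 2)
  have hsymm : ∀ u v : V → ℝ, u ⬝ᵥ (L *ᵥ v) = v ⬝ᵥ (L *ᵥ u) := fun u v => by
    rw [dotProduct_mulVec, ← mulVec_transpose, hL, dotProduct_comm]
  have hQ' : ∀ t, HasDerivAt (fun t => θ t ⬝ᵥ (L *ᵥ θ t)) (2 * (ω t ⬝ᵥ (L *ᵥ θ t))) t := by
    intro t
    have hLθ : ∀ i, HasDerivAt (fun t => (L *ᵥ θ t) i) ((L *ᵥ ω t) i) t := fun i =>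
      HasDerivAt.fun_sum fun j _ => (hθ t j).const_mul (L i j)
    have h : HasDerivAt (fun t => ∑ i, θ t i * (L *ᵥ θ t) i)
        (∑ i, (ω t i * (L *ᵥ θ t) i + θ t i * (L *ᵥ ω t) i)) t :=
      HasDerivAt.fun_sum fun i _ => (hθ t i).mul (hLθ i)
    have e : ∑ i, (ω t i * (L *ᵥ θ t) i + θ t i * (L *ᵥ ω t) i) = 2 * (ω t ⬝ᵥ (L *ᵥ θ t)) := by
      rw [Finset.sum_add_distrib, two_mul]
      exact congrArg _ (hsymm (θ t) (ω t))
    rw [← e]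
    exact h
  have hH' : ∀ t, HasDerivAt H (-(2 * d) * ∑ i, ω t i ^ 2) t := by
    intro t
    have h : HasDerivAt H (∑ i, m i * (2 * ω t i * (-((L *ᵥ θ t) i + d * ω t i) / m i))
        + 2 * (ω t ⬝ᵥ (L *ᵥ θ t))) t := by
      refine HasDerivAt.add (HasDerivAt.fun_sum fun i _ => HasDerivAt.const_mul (m i) ?_) (hQ' t)
      simpa using (hω t i).fun_pow 2
    convert h using 1
    simp only [dotProduct, Finset.mul_sum, ← Finset.sum_add_distrib]
    refine Finset.sum_congr rfl fun i _ => ?_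
    have := (hm i).ne'
    field_simp
    ring
  have hR' : ∀ t, HasDerivAt R (2 * ∑ i, m i * ω t i ^ 2 - 2 * (θ t ⬝ᵥ (L *ᵥ θ t))) t := by
    intro t
    have h : HasDerivAt R (∑ i, (2 * m i * (ω t i * ω t i
        + θ t i * (-((L *ᵥ θ t) i + d * ω t i) / m i)) + d * (2 * θ t i * ω t i))) t := by
      refine HasDerivAt.fun_sum fun i _ => HasDerivAt.add
        (HasDerivAt.const_mul _ ((hθ t i).mul (hω t i))) (HasDerivAt.const_mul _ ?_)
      simpa using (hθ t i).fun_pow 2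
    convert h using 1
    simp only [dotProduct, Finset.mul_sum, ← Finset.sum_sub_distrib]
    refine Finset.sum_congr rfl fun i _ => ?_
    have := (hm i).ne'
    field_simp
    ring
  have hS : 0 ≤ ∑ i, m i := Finset.sum_nonneg fun i _ => (hm i).le
  obtain ⟨ε, hε, hεm⟩ : ∃ ε : ℝ, 0 < ε ∧ ∀ i, 2 * ε * m i ≤ d := by
    refine ⟨d / (2 * (∑ i, m i + 1)), by positivity, fun i => ?_⟩
    have hi : m i ≤ ∑ i, m i := Finset.single_le_sum (fun i _ => (hm i).le) (Finset.mem_univ i)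
    have : 2 * (d / (2 * (∑ i, m i + 1))) * m i = d * (m i / (∑ i, m i + 1)) := by
      field_simp
    rw [this]
    exact mul_le_of_le_one_right hd.le ((div_le_one (by positivity)).2 (by linarith))
  -- Completing the square: `mω² + ε(2mθω + dθ²) = m(ω + εθ)² + ε(d - εm)θ²`.
  have hnn : ∀ t, 0 ≤ H t + ε * R t := by
    intro t
    have e : H t + ε * R t = ∑ i, (m i * ω t i ^ 2
        + ε * (2 * m i * (θ t i * ω t i) + d * θ t i ^ 2)) + θ t ⬝ᵥ (L *ᵥ θ t) := by
      simp only [H, R]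
      rw [Finset.sum_add_distrib (f := fun i => m i * ω t i ^ 2), ← Finset.mul_sum]
      ring
    rw [e]
    refine add_nonneg (Finset.sum_nonneg fun i _ => ?_) (hL0 _)
    have h1 := mul_nonneg (hm i).le (sq_nonneg (ω t i + ε * θ t i))
    have h2 := mul_nonneg (mul_nonneg hε.le (sq_nonneg (θ t i)))
      (show 0 ≤ d - ε * m i by nlinarith [hεm i, mul_pos hε (hm i)])
    nlinarith
  -- The weight `2εt` makes the potential terms in `F'` cancel. What remains is at most `-2d ∑ ω² +
  -- 4ε ∑ mω²`, nonpositive because `2εm ≤ d`. Hence `2εtH ≤ F(0)` and `H = O(1/t)`, although `θ`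
  -- itself need not decay.
  let F : ℝ → ℝ := fun t => H t + ε * R t + 2 * ε * (t * H t)
  have hF' : ∀ t, HasDerivAt F (-(2 * d) * ∑ i, ω t i ^ 2
      + ε * (2 * ∑ i, m i * ω t i ^ 2 - 2 * (θ t ⬝ᵥ (L *ᵥ θ t)))
      + 2 * ε * (1 * H t + t * (-(2 * d) * ∑ i, ω t i ^ 2))) t := fun t =>
    ((hH' t).add ((hR' t).const_mul ε)).add (((hasDerivAt_id t).mul (hH' t)).const_mul (2 * ε))
  have hanti : AntitoneOn F (Set.Ici 0) := by
    refine antitoneOn_of_deriv_nonpos (convex_Ici 0)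
      (fun t _ => (hF' t).continuousAt.continuousWithinAt)
      (fun t _ => (hF' t).differentiableAt.differentiableWithinAt) fun t ht => ?_
    rw [interior_Ici] at ht
    rw [(hF' t).deriv]
    have hw : 0 ≤ ∑ i, ω t i ^ 2 := Finset.sum_nonneg fun i _ => sq_nonneg _
    have h1 : 2 * ε * ∑ i, m i * ω t i ^ 2 ≤ d * ∑ i, ω t i ^ 2 := by
      simp only [Finset.mul_sum]
      exact Finset.sum_le_sum fun i _ => by nlinarith [hεm i, sq_nonneg (ω t i)]
    have h2 : 0 ≤ ε * (t * (d * ∑ i, ω t i ^ 2)) :=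
      mul_nonneg hε.le (mul_nonneg (le_of_lt ht) (mul_nonneg hd.le hw))
    simp only [H]
    nlinarith
  have hH0 : ∀ t, 0 ≤ H t := fun t =>
    add_nonneg (Finset.sum_nonneg fun i _ => mul_nonneg (hm i).le (sq_nonneg _)) (hL0 _)
  have hbound : ∀ᶠ t in atTop, H t ≤ (F 0 / (2 * ε)) / t := by
    filter_upwards [eventually_gt_atTop 0] with t ht
    have h1 : F t ≤ F 0 := hanti Set.self_mem_Ici (Set.mem_Ici.2 ht.le) ht.le
    have h2 := hnn t
    rw [div_div, le_div_iff₀ (by positivity)]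
    simp only [F] at h1 ⊢
    nlinarith
  exact tendsto_of_tendsto_of_tendsto_of_le_of_le' tendsto_const_nhds
    (tendsto_const_nhds.div_atTop tendsto_id) (Eventually.of_forall hH0) hbound

/-! ### Swing dynamics: output stability and the Lyapunov solution -/

section Swing

variable {V : Type*} [Fintype V] [DecidableEq V]

theorem inv_diagonal_of_pos {m : V → ℝ} (hm : ∀ i, 0 < m i) :
    (diagonal m)⁻¹ = diagonal fun i => (m i)⁻¹ := by
  refine inv_eq_right_inv ?_
  rw [diagonal_mul_diagonal, ← diagonal_one]
  congr 1
  funext i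
  exact mul_inv_cancel₀ (hm i).ne'

theorem transpose_sqrt {L : Matrix V V ℝ} : (CFC.sqrt L)ᵀ = CFC.sqrt L := by
  have h : (CFC.sqrt L).PosSemidef := (CFC.sqrt_nonneg L).posSemidef
  simpa [IsHermitian] using h.isHermitian

theorem swingC_transpose_mul_self {Lw S : Matrix V V ℝ} (hL : Lw.PosSemidef)
    (hS : S.PosSemidef) : (swingC Lw S)ᵀ * swingC Lw S = fromBlocks Lw 0 0 S := by
  rw [swingC, fromBlocks_transpose, fromBlocks_multiply]
  simp [transpose_sqrt, CFC.sqrt_mul_sqrt_self _ hL.nonneg, CFC.sqrt_mul_sqrt_self _ hS.nonneg]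

/-- Only `CᵀC` enters the squared output, so the matrix square roots disappear. -/
theorem sum_sq_swingC_mul {Lw S : Matrix V V ℝ} (hL : Lw.PosSemidef) (hS : S.PosSemidef)
    {k : Type*} (X : Matrix (V ⊕ V) k ℝ) (j : k) :
    ∑ q, (swingC Lw S * X) q j ^ 2
      = (fun i => X (.inl i) j) ⬝ᵥ (Lw *ᵥ fun i => X (.inl i) j)
        + (fun i => X (.inr i) j) ⬝ᵥ (S *ᵥ fun i => X (.inr i) j) := by
  have h1 : ∑ q, (swingC Lw S * X) q j ^ 2
      = (fun l => X l j) ⬝ᵥ (((swingC Lw S)ᵀ * swingC Lw S) *ᵥ fun l => X l j) := by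
    rw [← mulVec_mulVec, dotProduct_mulVec, vecMul_transpose]
    simp only [sq]
    rfl
  rw [h1, swingC_transpose_mul_self hL hS]
  simp [dotProduct, mulVec, fromBlocks_apply₁₁]

/-- The swing dynamics is stable as seen from the outputs: all solutions approach a common constant
phase at rest. -/
theorem tendsto_swingC_mul_exp {G : SimpleGraph V} [DecidableRel G.Adj] (hG : G.Connected)
    {b : V → V → ℝ} (hb_symm : ∀ i j, b i j = b j i) (hb_pos : ∀ i j, G.Adj i j → 0 < b i j)
    {w : V → V → ℝ} (hw_symm : ∀ i j, w i j = w j i) (hw_nonneg : ∀ i j, 0 ≤ w i j)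
    {s : V → ℝ} (hs : ∀ i, 0 ≤ s i) {m : V → ℝ} (hm : ∀ i, 0 < m i) {d : ℝ} (hd : 0 < d)
    (q j : V ⊕ V) :
    Tendsto (fun t : ℝ => (swingC (weightedLaplacian ⊤ w) (diagonal s) * NormedSpace.exp
      (t • swingA (diagonal m) (diagonal fun _ => d) (weightedLaplacian G b))) q j)
      atTop (𝓝 0) := by
  set Lb := weightedLaplacian G b
  set A := swingA (diagonal m) (diagonal fun _ => d) Lb with hA
  let X : ℝ → Matrix (V ⊕ V) (V ⊕ V) ℝ := fun t => NormedSpace.exp (t • A)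
  -- The `j`-th column of `exp(tA)` is the trajectory started at a basis vector; split it into
  -- phases and frequencies.
  let θ : ℝ → V → ℝ := fun t i => X t (.inl i) j
  let ω : ℝ → V → ℝ := fun t i => X t (.inr i) j
  have hX : ∀ t l, HasDerivAt (fun t => X t l j) ((A * X t) l j) t := fun t l => by
    have h := hasDerivAt_mul_exp_apply A 1 t l j
    simp only [Matrix.one_mul] at h
    rwa [← mul_exp_smul_comm] at h
  have hθ : ∀ t i, HasDerivAt (fun t => θ t i) (ω t i) t := fun t i => by
    convert hX t (.inl i) using 1
    simp [mul_apply, hA, swingA, ω, one_apply]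
  have hω : ∀ t i, HasDerivAt (fun t => ω t i) (-((Lb *ᵥ θ t) i + d * ω t i) / m i) t :=
    fun t i => by
    convert hX t (.inr i) using 1
    rw [mul_apply, Fintype.sum_sum_type]
    have e1 : ∀ l, A (.inr i) (.inl l) = -((m i)⁻¹ * Lb i l) := fun l => by
      rw [hA, swingA, fromBlocks_apply₂₁, Matrix.neg_apply, inv_diagonal_of_pos hm, diagonal_mul]
    have e2 : ∀ l, A (.inr i) (.inr l) = -(if i = l then (m i)⁻¹ * d else 0) := fun l => by
      rw [hA, swingA, fromBlocks_apply₂₂, Matrix.neg_apply, inv_diagonal_of_pos hm,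
        diagonal_mul_diagonal, diagonal_apply]
    simp only [e1, e2, neg_mul, ite_mul, zero_mul, Finset.sum_neg_distrib, Finset.sum_ite_eq,
      Finset.mem_univ, if_true, mul_assoc, ← Finset.mul_sum]
    have e : ∑ l, Lb i l * X t (.inl l) j = (Lb *ᵥ θ t) i := rfl
    rw [e, div_eq_inv_mul]
    simp only [ω]
    ring
  have hb0 : ∀ v, 0 ≤ v ⬝ᵥ (Lb *ᵥ v) :=
    weightedLaplacian_quadratic_nonneg G hb_symm fun i j h => (hb_pos i j h).le
  have hE := tendsto_energy_zero (weightedLaplacian_transpose G hb_symm) hb0 hm hd hθ hω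
  have hω0 : ∀ i, Tendsto (fun t => ω t i ^ 2) atTop (𝓝 0) := by
    intro i
    have h1 : Tendsto (fun t => m i * ω t i ^ 2) atTop (𝓝 0) := by
      refine squeeze_zero (fun t => mul_nonneg (hm i).le (sq_nonneg _)) (fun t => ?_) hE
      have h2 := Finset.single_le_sum (f := fun i => m i * ω t i ^ 2)
        (fun i _ => mul_nonneg (hm i).le (sq_nonneg _)) (Finset.mem_univ i)
      exact h2.trans (le_add_of_nonneg_right (hb0 _))
    have h3 := h1.const_mul (m i)⁻¹
    simpa [← mul_assoc, inv_mul_cancel₀ (hm i).ne'] using h3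
  have hLθ : Tendsto (fun t => θ t ⬝ᵥ (Lb *ᵥ θ t)) atTop (𝓝 0) :=
    squeeze_zero (fun t => hb0 _) (fun t => le_add_of_nonneg_left
      (Finset.sum_nonneg fun i _ => mul_nonneg (hm i).le (sq_nonneg _))) hE
  have hθ0 : ∀ i l, Tendsto (fun t => (θ t i - θ t l) ^ 2) atTop (𝓝 0) := by
    intro i l
    obtain ⟨p⟩ := hG.preconnected i l
    obtain ⟨K, hK⟩ := exists_sq_sub_le_of_walk hb_symm hb_pos p
    refine squeeze_zero (fun t => sq_nonneg _) (fun t => hK (θ t)) ?_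
    simpa using hLθ.const_mul K
  have hw : (weightedLaplacian ⊤ w).PosSemidef :=
    weightedLaplacian_posSemidef ⊤ hw_symm fun i j _ => hw_nonneg i j
  have hS : (diagonal s).PosSemidef := PosSemidef.diagonal hs
  have hsum : Tendsto (fun t => ∑ q, (swingC (weightedLaplacian ⊤ w) (diagonal s) * X t) q j ^ 2)
      atTop (𝓝 0) := by
    -- The `L_w` part involves only phase differences, which vanish even when the common phase does
    -- not.
    simp only [sum_sq_swingC_mul hw hS, dotProduct_weightedLaplacian_mulVec ⊤ hw_symm]
    have h1 : Tendsto (fun t => (∑ i, ∑ l, (if (⊤ : SimpleGraph V).Adj i l then w i l else 0)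
        * (θ t i - θ t l) ^ 2) / 2) atTop (𝓝 ((∑ i : V, ∑ l : V,
          (if (⊤ : SimpleGraph V).Adj i l then w i l else 0) * 0) / 2)) :=
      (tendsto_finsetSum _ fun i _ => tendsto_finsetSum _ fun l _ =>
        (hθ0 i l).const_mul _).div_const 2
    have h2 : Tendsto (fun t => ∑ i, s i * ω t i ^ 2) atTop (𝓝 (∑ i, s i * 0)) :=
      tendsto_finsetSum _ fun i _ => (hω0 i).const_mul _
    have h3 : ∀ v : V → ℝ, v ⬝ᵥ (diagonal s *ᵥ v) = ∑ i, s i * v i ^ 2 := fun v => by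
      simp only [dotProduct, mulVec_diagonal]
      exact Finset.sum_congr rfl fun i _ => by ring
    simp only [h3]
    simpa using h1.add h2
  have hsq : Tendsto (fun t => (swingC (weightedLaplacian ⊤ w) (diagonal s) * X t) q j ^ 2)
      atTop (𝓝 0) :=
    squeeze_zero (fun t => sq_nonneg _) (fun t => Finset.single_le_sum
      (f := fun q => (swingC (weightedLaplacian ⊤ w) (diagonal s) * X t) q j ^ 2)
      (fun q _ => sq_nonneg _) (Finset.mem_univ q)) hsum
  refine (tendsto_zero_iff_abs_tendsto_zero _).2 ?_
  simpa [Real.sqrt_sq_eq_abs, Function.comp_def] using hsq.sqrt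

theorem exp_mul_eq_of_mul_eq_zero {n k : Type*} [Fintype n] [DecidableEq n] {A : Matrix n n ℝ}
    {Y : Matrix n k ℝ} (h : A * Y = 0) (t : ℝ) : NormedSpace.exp (t • A) * Y = Y := by
  ext i j
  have hd : ∀ t, HasDerivAt (fun t : ℝ => (NormedSpace.exp (t • A) * Y) i j) 0 t := fun t => by
    have := hasDerivAt_mul_exp_mul_apply A 1 Y t i j
    simpa [Matrix.mul_assoc, h] using this
  have := is_const_of_deriv_eq_zero (fun t => (hd t).differentiableAt) (fun t => (hd t).deriv) t 0
  simpa [NormedSpace.exp_zero] using this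

/-- Directions annihilated by the dynamics are invisible to a stable output. -/
theorem mul_exp_mul_eq_zero_of_mul_eq_zero {n k p : Type*} [Fintype n] [DecidableEq n]
    {A : Matrix n n ℝ} {C : Matrix p n ℝ}
    (hC : ∀ i j, Tendsto (fun t : ℝ => (C * NormedSpace.exp (t • A)) i j) atTop (𝓝 0))
    {Y : Matrix n k ℝ} (h : A * Y = 0) (t : ℝ) : C * NormedSpace.exp (t • A) * Y = 0 := by
  -- A function of time that is constant and tends to zero is zero.
  have hconst : ∀ t : ℝ, C * NormedSpace.exp (t • A) * Y = C * Y := fun t => by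
    rw [Matrix.mul_assoc, exp_mul_eq_of_mul_eq_zero h]
  rw [hconst]
  ext i j
  have h1 : Tendsto (fun t : ℝ => (C * NormedSpace.exp (t • A) * Y) i j) atTop
      (𝓝 (∑ l, 0 * Y l j)) := tendsto_finsetSum _ fun l _ => (hC i l).mul_const _
  simp only [hconst, zero_mul, Finset.sum_const_zero] at h1
  exact tendsto_nhds_unique tendsto_const_nhds h1

/-- Pure phase displacements in `ker L` are equilibria. -/
theorem swingA_mul_fromBlocks_eq_zero {M D L Q : Matrix V V ℝ} (h : L * Q = 0) :
    swingA M D L * fromBlocks 0 Q 0 0 = 0 := by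
  rw [swingA, fromBlocks_multiply]
  simp [Matrix.mul_assoc, h]

/-- The block-diagonal matrix of `L⁺` and `M⁻¹` solves the Lyapunov equation of the uniformly damped
swing dynamics up to terms along the kernel of `L`. -/
theorem swing_lyapunov {m : V → ℝ} (hm : ∀ i, 0 < m i) {d : ℝ} (hd : 0 < d)
    {L : Matrix V V ℝ} (hL : Lᵀ = L) (Y : Matrix V V ℝ) :
    swingA (diagonal m) (diagonal fun _ => d) L
        * ((2 * d)⁻¹ • fromBlocks Y 0 0 (diagonal m)⁻¹)
      + ((2 * d)⁻¹ • fromBlocks Y 0 0 (diagonal m)⁻¹)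
        * (swingA (diagonal m) (diagonal fun _ => d) L)ᵀ
      + swingB (diagonal m) * (swingB (diagonal m))ᵀ
    = (2 * d)⁻¹ • (fromBlocks 0 ((1 - Y * L) * (diagonal m)⁻¹) 0 0
        + (fromBlocks 0 ((1 - L * Y)ᵀ * (diagonal m)⁻¹) 0 0)ᵀ) := by
  have hB : swingB (diagonal m) * (swingB (diagonal m))ᵀ
      = (2 * d)⁻¹ • fromBlocks 0 0 0 ((2 * d) • ((diagonal m)⁻¹ * (diagonal m)⁻¹)) := by
    rw [fromBlocks_smul, smul_smul, inv_mul_cancel₀ (by positivity), one_smul, swingB,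
      transpose_fromRows, fromRows_mul_fromCols]
    simp [inv_diagonal_of_pos hm]
  rw [hB, Matrix.mul_smul, Matrix.smul_mul, ← smul_add, ← smul_add]
  congr 1
  rw [swingA, fromBlocks_transpose, fromBlocks_transpose, fromBlocks_multiply, fromBlocks_multiply,
    fromBlocks_add, fromBlocks_add, fromBlocks_add]
  have hdd : (diagonal fun _ : V => d) = d • (1 : Matrix V V ℝ) := (smul_one_eq_diagonal d).symm
  have ht : ((diagonal m)⁻¹)ᵀ = (diagonal m)⁻¹ := by
    rw [inv_diagonal_of_pos hm, diagonal_transpose]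
  -- The phase block is zero. The off-diagonal blocks give the residual. In the frequency block the
  -- two damping terms cancel `BBᵀ`; the common factor `(2d)⁻¹` works because the damping is scalar.
  congr 1
  · simp
  · simp [ht, hL, Matrix.add_mul, Matrix.mul_assoc, sub_eq_add_neg]
  · simp [ht, hL, Matrix.mul_add, Matrix.mul_assoc, sub_eq_neg_add]
  · simp only [hdd, transpose_neg, transpose_mul, transpose_smul, ht,
      Matrix.mul_smul, Matrix.smul_mul, Matrix.mul_one, Matrix.mul_zero,
      Matrix.zero_mul, Matrix.neg_mul, Matrix.mul_neg, zero_add, transpose_zero, add_zero]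
    module

end Swing

/-! ### Main theorem -/

theorem lemma1 {V : Type*} [Fintype V] [DecidableEq V]
    (G : SimpleGraph V) [DecidableRel G.Adj] (hG : G.Connected)
    (b : V → V → ℝ) (hb_symm : ∀ i j, b i j = b j i) (hb_pos : ∀ i j, G.Adj i j → 0 < b i j)
    (w : V → V → ℝ) (hw_symm : ∀ i j, w i j = w j i) (hw_nonneg : ∀ i j, 0 ≤ w i j)
    (s : V → ℝ) (hs : ∀ i, 0 ≤ s i)
    (m : V → ℝ) (hm : ∀ i, 0 < m i)
    (D : V → ℝ) (d : ℝ) (hd : 0 < d) (hD : ∀ i, D i = d)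
    (M : Matrix V V ℝ) (hM : M = Matrix.diagonal m)
    (S : Matrix V V ℝ) (hS : S = Matrix.diagonal s)
    (Lb : Matrix V V ℝ) (hLb : Lb = weightedLaplacian G b)
    (Lw : Matrix V V ℝ) (hLw : Lw = weightedLaplacian ⊤ w) :
    HasH2NormSq (swingA M (Matrix.diagonal D) Lb) (swingB M) (swingC Lw S)
      (((Lw * pinv Lb).trace + (S * M⁻¹).trace) / (2 * d)) ∧
    HasSteadyStateVariance.{u} (swingA M (Matrix.diagonal D) Lb) (swingB M) (swingC Lw S)
      (((Lw * pinv Lb).trace + (S * M⁻¹).trace) / (2 * d)) := by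
  obtain rfl : D = fun _ => d := funext hD
  have hC : ∀ i j, Tendsto (fun t : ℝ => (swingC Lw S
      * NormedSpace.exp (t • swingA M (Matrix.diagonal fun _ => d) Lb)) i j) atTop (𝓝 0) := by
    subst hM hS hLb hLw
    exact tendsto_swingC_mul_exp hG hb_symm hb_pos hw_symm hw_nonneg hs hm hd
  have hLbt : Lbᵀ = Lb := hLb ▸ weightedLaplacian_transpose G hb_symm
  have hpinv : IsMoorePenroseInverse Lb (pinv Lb) := pinv_spec (by
    rw [IsHermitian, conjTranspose_eq_transpose_of_trivial, hLbt])
  have hLwp : Lw.PosSemidef :=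
    hLw ▸ weightedLaplacian_posSemidef ⊤ hw_symm fun i j _ => hw_nonneg i j
  have hSp : S.PosSemidef := hS ▸ PosSemidef.diagonal hs
  have hH2 : HasH2NormSq (swingA M (Matrix.diagonal fun _ => d) Lb) (swingB M) (swingC Lw S)
      (((Lw * pinv Lb).trace + (S * M⁻¹).trace) / (2 * d)) := by
    have h := hasH2NormSq_of_lyapunov (P := (2 * d)⁻¹ • fromBlocks (pinv Lb) 0 0 M⁻¹)
      (B := swingB M) hC fun t => by
        have hQ1 : Lb * ((1 - pinv Lb * Lb) * M⁻¹) = 0 := by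
          rw [← Matrix.mul_assoc, Matrix.mul_sub, Matrix.mul_one, ← Matrix.mul_assoc,
            hpinv.mul_mul_self, sub_self, Matrix.zero_mul]
        have hQ2 : Lb * ((1 - Lb * pinv Lb)ᵀ * M⁻¹) = 0 := by
          have : Lb * (1 - Lb * pinv Lb)ᵀ = 0 := by
            rw [← transpose_inj, transpose_mul, transpose_transpose, hLbt, Matrix.sub_mul,
              Matrix.one_mul, hpinv.mul_mul_self, sub_self, transpose_zero]
          rw [← Matrix.mul_assoc, this, Matrix.zero_mul]
        have h1 := mul_exp_mul_eq_zero_of_mul_eq_zero hC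
          (swingA_mul_fromBlocks_eq_zero (M := M) (D := Matrix.diagonal fun _ => d) hQ1) t
        have h2 := mul_exp_mul_eq_zero_of_mul_eq_zero hC
          (swingA_mul_fromBlocks_eq_zero (M := M) (D := Matrix.diagonal fun _ => d) hQ2) t
        rw [hM] at h1 h2 ⊢
        -- One residual term is annihilated by `C exp(tA)` on the left, the other, being a
        -- transpose, by its transpose on the right.
        rw [swing_lyapunov hm hd hLbt, Matrix.mul_smul, Matrix.smul_mul, Matrix.mul_add, h1,
          zero_add, Matrix.mul_assoc, ← transpose_mul, h2, transpose_zero, Matrix.mul_zero,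
          smul_zero]
    convert h using 1
    -- Cyclicity turns `Tr(CPCᵀ)` into `Tr(CᵀC P)` with `CᵀC = diag(L_w, S)`.
    rw [trace_mul_comm (swingC Lw S * _), ← Matrix.mul_assoc, swingC_transpose_mul_self hLwp hSp, Matrix.mul_smul,
      trace_smul, fromBlocks_multiply]
    simp only [trace, diag_apply, Fintype.sum_sum_type, fromBlocks_apply₁₁, fromBlocks_apply₂₂,
      Matrix.zero_mul, Matrix.mul_zero, add_zero, zero_add, smul_eq_mul, div_eq_inv_mul]
  exact ⟨hH2, hH2.hasSteadyStateVariance hC⟩
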